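/- For $v\in\mathbb{R}$ and $x>0$ let $$I_v(x)=\sum_{n=0}^\infty \frac{(x/2)^{2n+v}}{n!\,\Gamma(v+n+1)}$$ be the modified Bessel function of the first kind (with $1/\Gamma=0$ at the poles of $\Gamma$), and let $$K_v(x)=\frac{\pi}{2}\,\frac{I_{-v}(x)-I_v(x)}{\sin(v\pi)}$$ be the modified Bessel function of the second kind, where for integer $v$ the right-hand side is replaced by its limiting value in $v$. Let $v\ge 0$. Then $K_v$ is positive and differentiable on $(0,\infty)$, so that the function $$\Lambda(x)=x+\frac{xK_v'(x)}{K_v(x)},\qquad x>0,$$ is well defined, and the following hold. (i) If $v>1/2$, then $\Lambda$ is strictly increasing from $(0,\infty)$ onto $(-v,-1/2)$. (ii) If $0\le v<1/2$, then $\Lambda$ is strictly decreasing from $(0,\infty)$ onto $(-1/2,-v)$. (iii) If $v\neq 1/2$, then for all $x>0$ $$-x-\max\left(v,\tfrac12\right)<\frac{xK_v'(x)}{K_v(x)}<-x-\min\left(v,\tfrac12\right),$$ and the constants are best possible: if $a\in\mathbb{R}$ satisfies $-x-a\le xK_v'(x)/K_v(x)$ for all $x>0$, then $a\ge\max(v,1/2)$;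 and if $b\in\mathbb{R}$ satisfies $xK_v'(x)/K_v(x)\le -x-b$ for all $x>0$, then $b\le\min(v,1/2)$. -/

import Mathlib

open Filter Topology Set

noncomputable section

/-- The modified Bessel function of the first kind (for positive `x`),
`I_v(x) = ∑ₙ (x/2)^(2n+v) / (n! Γ(v+n+1))`. -/
def besselI (v x : ℝ) : ℝ :=
  ∑' n : ℕ, (x / 2) ^ (2 * (n : ℝ) + v) / ((n.factorial : ℝ) * Real.Gamma (v + n + 1))

/-- The quotient `(π/2) (I_{-v}(x) - I_v(x)) / sin(vπ)`, meaningful for non-integer `v`. -/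
def besselKQuot (v x : ℝ) : ℝ :=
  Real.pi / 2 * ((besselI (-v) x - besselI v x) / Real.sin (v * Real.pi))

open Classical in
/-- The modified Bessel function of the second kind (for positive `x`): the quotient above,
replaced by its limiting value (in the order) when the order `v` is an integer. -/
def besselK (v x : ℝ) : ℝ :=
  if ∃ n : ℤ, v = n then limUnder (𝓝[≠] v) (fun w : ℝ => besselKQuot w x)
  else besselKQuot v x

/-- `Λ(x) = x + x K_v'(x) / K_v(x)`, the derivative being taken in `x`. -/
def besselLambda (v x : ℝ) : ℝ :=
  x + x * deriv (besselK v) x / besselK v x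

end

/-! Everything rests on `K_v(x) = ½ ∫ exp(-x cosh t + v t) dt` (`besselK_eq_besselKInt`). The
integral is positive, even in `v`, and satisfies recurrences between neighbouring orders; these give
the Riccati equation `Λ' = (v² - Λ²)/x + (2Λ + 1)`. Integration by parts also gives the crude bound
`-(v + 1/2) ≤ Λ < 0`. If `Λ` reached or passed an end of the interval between `-v` and `-1/2`, both
terms would push it outwards, at least one strictly, and it would grow like `log x` or `x`, against
the crude bound. Inside the interval the two terms have opposite signs. A derivative of the wrong
sign would persist and again force linear growth, so `Λ` is monotone. A level missed near `0` or
near `∞` is excluded by the divergence of `∫ dx/x` or of `∫ dx`. Hence the range is the whole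
interval, and (iii) reads off its endpoints. For the representation with `0 < v < 1`, integral and
quotient solve the same first-order system in the orders `v` and `1 - v`, with the same leading term
at `0`; an energy estimate makes the difference vanish. The recurrence carries this to all
nonintegral orders, and continuity in the order to the integers. -/

/-! ### The integral: convergence, recurrences, derivative, continuity in the order -/

theorem one_add_sq_div_two_le_cosh (t : ℝ) : 1 + t ^ 2 / 2 ≤ Real.cosh t := by
  have h1 : Real.cosh t = 1 + 2 * Real.sinh (t / 2) ^ 2 := by
    have := Real.cosh_two_mul (t / 2)
    rw [mul_div_cancel₀ t two_ne_zero, Real.cosh_sq] at this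
    linarith
  have h2 : (t / 2) ^ 2 ≤ Real.sinh (t / 2) ^ 2 := by
    rw [sq_le_sq]
    rcases le_total 0 (t / 2) with h | h
    · have := Real.self_le_sinh_iff.2 h
      rwa [abs_of_nonneg h, abs_of_nonneg (h.trans this)]
    · have := Real.sinh_le_self_iff.2 h
      rw [abs_of_nonpos h, abs_of_nonpos (this.trans h)]
      linarith
  rw [h1]
  nlinarith

/-- The integrand of the integral representation of `K_v` over the whole line. -/
noncomputable def besselKernel (x v t : ℝ) : ℝ := Real.exp (-x * Real.cosh t + v * t)

/-- The integral `½ ∫ exp (-x cosh t + v t) dt` over the whole line. -/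
noncomputable def besselKInt (v x : ℝ) : ℝ := 1 / 2 * ∫ t, besselKernel x v t

theorem besselKernel_pos (x v t : ℝ) : 0 < besselKernel x v t := Real.exp_pos _

theorem continuous_besselKernel (x v : ℝ) : Continuous (besselKernel x v) := by
  unfold besselKernel
  have := Real.continuous_cosh
  fun_prop

theorem integrable_besselKernel {x : ℝ} (hx : 0 < x) (v : ℝ) :
    MeasureTheory.Integrable (besselKernel x v) := by
  -- Half of the decay `x t²/2` absorbs `v t` by completing the square, at the price of the factor
  -- `exp(v²/x)`.
  have h := (integrable_exp_neg_mul_sq (b := x / 4) (by positivity)).const_mul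
    (Real.exp (v ^ 2 / x))
  refine h.mono' (continuous_besselKernel x v).aestronglyMeasurable (.of_forall fun t => ?_)
  rw [Real.norm_of_nonneg (besselKernel_pos x v t).le, besselKernel, ← Real.exp_add]
  refine Real.exp_le_exp.2 ?_
  have h1 := mul_le_mul_of_nonneg_left (one_add_sq_div_two_le_cosh t) hx.le
  have h2 : v ^ 2 / x - v * t + x / 4 * t ^ 2 = (v - x * t / 2) ^ 2 / x := by
    field_simp
    ring
  have h3 : 0 ≤ (v - x * t / 2) ^ 2 / x := by positivity
  nlinarith

theorem cosh_mul_besselKernel (x v t : ℝ) :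
    Real.cosh t * besselKernel x v t =
      1 / 2 * (besselKernel x (v + 1) t + besselKernel x (v - 1) t) := by
  simp only [besselKernel, Real.cosh_eq t, add_mul, sub_mul, Real.exp_add, Real.exp_sub, one_mul,
    Real.exp_neg]
  field_simp

theorem sinh_mul_besselKernel (x v t : ℝ) :
    Real.sinh t * besselKernel x v t =
      1 / 2 * (besselKernel x (v + 1) t - besselKernel x (v - 1) t) := by
  simp only [besselKernel, Real.sinh_eq t, add_mul, sub_mul, Real.exp_add, Real.exp_sub, one_mul,
    Real.exp_neg]
  field_simp

theorem integrable_cosh_mul_besselKernel {x : ℝ} (hx : 0 < x) (v : ℝ) :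
    MeasureTheory.Integrable fun t => Real.cosh t * besselKernel x v t := by
  simp only [cosh_mul_besselKernel]
  exact ((integrable_besselKernel hx _).add (integrable_besselKernel hx _)).const_mul _

theorem integrable_cosh_sub_one_mul_besselKernel {x : ℝ} (hx : 0 < x) (v : ℝ) :
    MeasureTheory.Integrable fun t => (Real.cosh t - 1) * besselKernel x v t := by
  simp only [sub_mul, one_mul]
  exact (integrable_cosh_mul_besselKernel hx v).sub (integrable_besselKernel hx v)

theorem integrable_sinh_mul_besselKernel {x : ℝ} (hx : 0 < x) (v : ℝ) :
    MeasureTheory.Integrable fun t => Real.sinh t * besselKernel x v t := by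
  simp only [sinh_mul_besselKernel]
  exact ((integrable_besselKernel hx _).sub (integrable_besselKernel hx _)).const_mul _

theorem hasDerivAt_besselKernel (x v t : ℝ) :
    HasDerivAt (besselKernel x v) ((-x * Real.sinh t + v) * besselKernel x v t) t := by
  have h := (((Real.hasDerivAt_cosh t).const_mul (-x)).add ((hasDerivAt_id t).const_mul v)).exp
  refine h.congr_deriv ?_
  simp only [besselKernel, id, Pi.add_apply]
  ring

theorem hasDerivAt_besselKernel_arg (x v t : ℝ) :
    HasDerivAt (fun y => besselKernel y v t) (-(Real.cosh t * besselKernel x v t)) x := by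
  have h := (((hasDerivAt_id x).neg.mul_const (Real.cosh t)).add_const (v * t)).exp
  refine h.congr_deriv ?_
  simp only [besselKernel, id, Pi.neg_apply]
  ring

theorem besselKInt_pos {x : ℝ} (hx : 0 < x) (v : ℝ) : 0 < besselKInt v x := by
  have := MeasureTheory.integral_exp_pos (integrable_besselKernel hx v)
  unfold besselKInt besselKernel
  positivity

theorem besselKInt_neg (v x : ℝ) : besselKInt (-v) x = besselKInt v x := by
  unfold besselKInt
  rw [← MeasureTheory.integral_neg_eq_self]
  simp [besselKernel]

/-- The `t`-derivative of the kernel has integral zero over the line. -/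
theorem besselKInt_add_one {x : ℝ} (hx : 0 < x) (v : ℝ) :
    x * (besselKInt (v + 1) x - besselKInt (v - 1) x) = 2 * v * besselKInt v x := by
  have h := MeasureTheory.integral_eq_zero_of_hasDerivAt_of_integrable
    (hasDerivAt_besselKernel x v)
    (((((integrable_sinh_mul_besselKernel hx v).const_mul (-x)).add
      ((integrable_besselKernel hx v).const_mul v))).congr
      (.of_forall fun t => by simp only [Pi.add_apply]; ring)) (integrable_besselKernel hx v)
  have h2 : ∀ t, (-x * Real.sinh t + v) * besselKernel x v t =
      -x * (1 / 2) * besselKernel x (v + 1) t + x * (1 / 2) * besselKernel x (v - 1) t +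
        v * besselKernel x v t := fun t => by
    rw [add_mul, mul_assoc, sinh_mul_besselKernel]; ring
  simp only [h2] at h
  have i := fun w c => (integrable_besselKernel hx w).const_mul c
  rw [MeasureTheory.integral_add ((i _ _).fun_add (i _ _)) (i _ _),
    MeasureTheory.integral_add (i _ _) (i _ _)] at h
  simp only [MeasureTheory.integral_const_mul] at h
  unfold besselKInt
  linear_combination -h

theorem hasDerivAt_besselKInt_cosh {x : ℝ} (hx : 0 < x) (v : ℝ) :
    HasDerivAt (besselKInt v) (-(1 / 2 * ∫ t, Real.cosh t * besselKernel x v t)) x := by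
  have h := (hasDerivAt_integral_of_dominated_loc_of_deriv_le (μ := MeasureTheory.volume)
    (F := fun y t => besselKernel y v t)
    (F' := fun y t => -(Real.cosh t * besselKernel y v t))
    (bound := fun t => Real.cosh t * besselKernel (x / 2) v t)
    (Ioi_mem_nhds (half_lt_self hx))
    (.of_forall fun y => (continuous_besselKernel y v).aestronglyMeasurable)
    (integrable_besselKernel hx v)
    (integrable_cosh_mul_besselKernel hx v).neg.aestronglyMeasurable
    (.of_forall fun t y hy => ?_)
    (integrable_cosh_mul_besselKernel (half_pos hx) v)
    (.of_forall fun t y _ => hasDerivAt_besselKernel_arg y v t)).2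
  · refine (h.const_mul (1 / 2)).congr_deriv ?_
    rw [MeasureTheory.integral_neg]
    ring
  · have hc := Real.cosh_pos t
    rw [norm_neg, Real.norm_of_nonneg (mul_pos hc (besselKernel_pos _ _ _)).le]
    refine mul_le_mul_of_nonneg_left (Real.exp_le_exp.2 ?_) hc.le
    have : x / 2 * Real.cosh t ≤ y * Real.cosh t :=
      mul_le_mul_of_nonneg_right (le_of_lt hy) hc.le
    linarith

theorem integral_cosh_mul_besselKernel {x : ℝ} (hx : 0 < x) (v : ℝ) :
    ∫ t, Real.cosh t * besselKernel x v t = besselKInt (v + 1) x + besselKInt (v - 1) x := by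
  simp only [cosh_mul_besselKernel]
  rw [MeasureTheory.integral_const_mul, MeasureTheory.integral_add
    (integrable_besselKernel hx _) (integrable_besselKernel hx _)]
  unfold besselKInt
  ring

theorem hasDerivAt_besselKInt {x : ℝ} (hx : 0 < x) (v : ℝ) :
    HasDerivAt (besselKInt v) (-besselKInt (v + 1) x + v / x * besselKInt v x) x := by
  refine (hasDerivAt_besselKInt_cosh hx v).congr_deriv ?_
  rw [integral_cosh_mul_besselKernel hx]
  have := besselKInt_add_one hx v
  field_simp
  linear_combination this

theorem continuous_besselKInt_order {x : ℝ} (hx : 0 < x) :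
    Continuous fun v => besselKInt v x := by
  refine continuous_iff_continuousAt.2 fun v => ?_
  refine ContinuousAt.mul continuousAt_const ?_
  refine MeasureTheory.continuousAt_of_dominated
    (bound := fun t => besselKernel x (v + 1) t + besselKernel x (v - 1) t)
    (.of_forall fun w => (continuous_besselKernel x w).aestronglyMeasurable) ?_
    ((integrable_besselKernel hx _).add (integrable_besselKernel hx _))
    (.of_forall fun t => ?_)
  · filter_upwards [Ioo_mem_nhds (sub_one_lt v) (lt_add_one v)] with w hw
    refine .of_forall fun t => ?_
    rw [Real.norm_of_nonneg (besselKernel_pos _ _ _).le]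
    rcases le_total 0 t with h | h
    · have : besselKernel x w t ≤ besselKernel x (v + 1) t := by
        refine Real.exp_le_exp.2 ?_
        nlinarith [mul_le_mul_of_nonneg_right hw.2.le h]
      linarith [besselKernel_pos x (v - 1) t]
    · have : besselKernel x w t ≤ besselKernel x (v - 1) t := by
        refine Real.exp_le_exp.2 ?_
        nlinarith [mul_le_mul_of_nonpos_right hw.1.le h]
      linarith [besselKernel_pos x (v + 1) t]
  · unfold besselKernel
    fun_prop

/-! ### The crude bound on `Λ` -/

/-- Integrate the derivative of `tanh(t/2)` times the kernel, with `tanh(t/2)` written `sinh t / (1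
+ cosh t)`. Since `tanh(t/2) sinh t = cosh t - 1`, the left side equals the integral of the kernel
against `1/(1 + cosh t) + v tanh(t/2)`, a weight at most `1/2 + v`. -/
theorem mul_integral_cosh_sub_one_le {x : ℝ} (hx : 0 < x) {v : ℝ} (hv : 0 ≤ v) :
    x * ∫ t, (Real.cosh t - 1) * besselKernel x v t ≤
      (v + 1 / 2) * ∫ t, besselKernel x v t := by
  have hd : ∀ t, HasDerivAt (fun t => Real.sinh t / (1 + Real.cosh t) * besselKernel x v t)
      (1 / (1 + Real.cosh t) * besselKernel x v t + v * (Real.sinh t / (1 + Real.cosh t)) *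
        besselKernel x v t - x * ((Real.cosh t - 1) * besselKernel x v t)) t := fun t => by
    have hc : (1 + Real.cosh t) ≠ 0 := by linarith [Real.cosh_pos t]
    have h := (((Real.hasDerivAt_sinh t).div ((Real.hasDerivAt_cosh t).const_add 1) hc)).mul
      (hasDerivAt_besselKernel x v t)
    refine h.congr_deriv ?_
    have hs := Real.cosh_sq t
    simp only [Pi.div_apply]
    field_simp
    have e : Real.sinh t ^ 2 = Real.cosh t ^ 2 - 1 := by linarith
    ring_nf
    simp only [e]
    ring
  have hs : ∀ t, |Real.sinh t / (1 + Real.cosh t)| ≤ 1 := fun t => by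
    have hc := Real.cosh_pos t
    rw [abs_div, abs_of_pos (by linarith : 0 < 1 + Real.cosh t), div_le_one (by linarith)]
    rw [abs_le]
    have h1 := Real.cosh_sub_sinh t
    have h2 := Real.cosh_add_sinh t
    have h3 := Real.exp_pos t
    have h4 := Real.exp_pos (-t)
    constructor <;> linarith
  have hc : ∀ t, 1 / (1 + Real.cosh t) ≤ 1 / 2 := fun t =>
    one_div_le_one_div_of_le two_pos (by linarith [Real.one_le_cosh t])
  have cont : Continuous fun t => Real.sinh t / (1 + Real.cosh t) :=
    Real.continuous_sinh.div (continuous_const.add Real.continuous_cosh)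
      fun t => by linarith [Real.cosh_pos t]
  have cont' : Continuous fun t => 1 / (1 + Real.cosh t) :=
    continuous_const.div (continuous_const.add Real.continuous_cosh)
      fun t => by linarith [Real.cosh_pos t]
  have ik := integrable_besselKernel hx v
  have i0 : MeasureTheory.Integrable
      fun t => Real.sinh t / (1 + Real.cosh t) * besselKernel x v t :=
    ik.bdd_mul cont.aestronglyMeasurable (.of_forall hs)
  have i1 : MeasureTheory.Integrable fun t => 1 / (1 + Real.cosh t) * besselKernel x v t := by
    refine ik.bdd_mul (c := 1 / 2) cont'.aestronglyMeasurable (.of_forall fun t => ?_)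
    rw [Real.norm_of_nonneg (by have := Real.cosh_pos t; positivity)]
    exact hc t
  have i2 : MeasureTheory.Integrable
      fun t => v * (Real.sinh t / (1 + Real.cosh t)) * besselKernel x v t := by
    simpa only [mul_assoc] using i0.const_mul v
  have i3 := integrable_cosh_sub_one_mul_besselKernel hx v
  have h := MeasureTheory.integral_eq_zero_of_hasDerivAt_of_integrable hd
    ((i1.add i2).sub (i3.const_mul x)) i0
  rw [MeasureTheory.integral_sub (i1.fun_add i2) (i3.const_mul x), sub_eq_zero,
    MeasureTheory.integral_const_mul] at h
  rw [← h, ← MeasureTheory.integral_const_mul]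
  refine MeasureTheory.integral_mono (i1.add i2) (ik.const_mul _) fun t => ?_
  have hk := besselKernel_pos x v t
  have := mul_le_mul_of_nonneg_left (abs_le.1 (hs t)).2 hv
  simp only [← add_mul]
  exact mul_le_mul_of_nonneg_right (by linarith [hc t]) hk.le

theorem integral_cosh_sub_one_pos {x : ℝ} (hx : 0 < x) (v : ℝ) :
    0 < ∫ t, (Real.cosh t - 1) * besselKernel x v t := by
  have i3 := integrable_cosh_sub_one_mul_besselKernel hx v
  refine MeasureTheory.integral_pos_of_integrable_nonneg_nonzero (x := 1)
    ((Real.continuous_cosh.sub continuous_const).mul (continuous_besselKernel x v)) i3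
    (fun t => mul_nonneg (by linarith [Real.one_le_cosh t]) (besselKernel_pos _ _ _).le) ?_
  have := Real.one_lt_cosh.2 (one_ne_zero (α := ℝ))
  exact mul_ne_zero (by linarith) (besselKernel_pos _ _ _).ne'

theorem add_mul_logDeriv_besselKInt_mem {x : ℝ} (hx : 0 < x) {v : ℝ} (hv : 0 ≤ v) :
    x + x * deriv (besselKInt v) x / besselKInt v x ∈ Ico (-(v + 1 / 2)) 0 := by
  have hJ := besselKInt_pos hx v
  have ik := integrable_besselKernel hx v
  have e : x + x * deriv (besselKInt v) x / besselKInt v x =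
      -(x * (1 / 2 * ∫ t, (Real.cosh t - 1) * besselKernel x v t)) / besselKInt v x := by
    rw [(hasDerivAt_besselKInt_cosh hx v).deriv]
    simp only [sub_mul, one_mul]
    rw [MeasureTheory.integral_sub (integrable_cosh_mul_besselKernel hx v) ik]
    field_simp
    unfold besselKInt
    ring
  rw [e]
  constructor
  · rw [le_div_iff₀ hJ]
    have := mul_integral_cosh_sub_one_le hx hv
    unfold besselKInt
    linarith
  · have := integral_cosh_sub_one_pos hx v
    exact div_neg_of_neg_of_pos (by rw [neg_lt_zero]; positivity) hJ

/-! ### Leading behaviour of the integral at zero -/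

theorem integral_exp_neg_exp_mul {v : ℝ} (hv : 0 < v) :
    ∫ s : ℝ, Real.exp (-(1 / 2 * Real.exp s) + v * s) = 2 ^ v * Real.Gamma v := by
  have h := MeasureTheory.integral_image_eq_integral_abs_deriv_smul MeasurableSet.univ
    (fun x _ => (Real.hasDerivAt_exp x).hasDerivWithinAt) Real.exp_injective.injOn
    (fun t : ℝ => t ^ (v - 1) * Real.exp (-(1 / 2 * t)))
  rw [image_univ, Real.range_exp, Real.integral_rpow_mul_exp_neg_mul_Ioi hv (by norm_num),
    MeasureTheory.setIntegral_univ] at h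
  norm_num at h
  rw [h]
  refine MeasureTheory.integral_congr_ae (.of_forall fun s => ?_)
  beta_reduce
  rw [← Real.exp_mul, ← mul_assoc, ← Real.exp_add, ← Real.exp_add]
  ring_nf

/-- The shift `t = s - log x` absorbs `x ^ v` and turns `x cosh t` into `(e^s + x² e^(-s))/2`.
Dropping the `x²` term gives both the dominating function and the limit, a Gamma integral. -/
theorem tendsto_rpow_mul_besselKInt {v : ℝ} (hv : 0 < v) :
    Tendsto (fun x => x ^ v * besselKInt v x) (𝓝[>] 0) (𝓝 (2 ^ (v - 1) * Real.Gamma v)) := by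
  have e : ∀ x ∈ Ioi (0 : ℝ), 1 / 2 * ∫ s : ℝ,
      Real.exp (-(1 / 2 * (Real.exp s + x ^ 2 * Real.exp (-s))) + v * s) =
        x ^ v * besselKInt v x := fun x (hx : 0 < x) => by
    unfold besselKInt
    rw [← MeasureTheory.integral_sub_right_eq_self (besselKernel x v) (Real.log x), mul_left_comm,
      ← MeasureTheory.integral_const_mul (x ^ v)]
    congr 1
    refine MeasureTheory.integral_congr_ae (.of_forall fun s => ?_)
    beta_reduce
    rw [besselKernel, Real.rpow_def_of_pos hx, ← Real.exp_add, Real.cosh_eq, neg_sub, Real.exp_sub,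
      Real.exp_sub, Real.exp_log hx, Real.exp_neg]
    congr 1
    field_simp
    ring
  refine Tendsto.congr' (eventually_nhdsWithin_of_forall e) ?_
  have hlim : (2 : ℝ) ^ (v - 1) * Real.Gamma v = 1 / 2 * (2 ^ v * Real.Gamma v) := by
    rw [Real.rpow_sub_one two_ne_zero]; ring
  rw [hlim, ← integral_exp_neg_exp_mul hv]
  refine Tendsto.const_mul _ ?_
  refine MeasureTheory.tendsto_integral_filter_of_dominated_convergence
    (fun s => Real.exp (-(1 / 2 * Real.exp s) + v * s))
    (.of_forall fun x => Continuous.aestronglyMeasurable (by fun_prop))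
    (.of_forall fun x => .of_forall fun s => ?_)
    -- A nonintegrable function has integral `0` by convention, so the nonzero Gamma value already
    -- yields integrability of the bound.
    (.of_integral_ne_zero ?_) (.of_forall fun s => ?_)
  · rw [Real.norm_of_nonneg (Real.exp_pos _).le]
    refine Real.exp_le_exp.2 ?_
    have : 0 ≤ x ^ 2 * Real.exp (-s) := by positivity
    linarith
  · rw [integral_exp_neg_exp_mul hv]
    have := Real.Gamma_pos_of_pos hv
    positivity
  · have : Continuous fun x : ℝ =>
        Real.exp (-(1 / 2 * (Real.exp s + x ^ 2 * Real.exp (-s))) + v * s) := by fun_prop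
    simpa using (this.tendsto 0).mono_left nhdsWithin_le_nhds

/-! ### Power series and recurrences for `I_v` at nonintegral order -/

/-- The Taylor coefficients of `z ↦ z^(-v/2) I_v(2√z)`. -/
noncomputable def besselCoeff (v : ℝ) (n : ℕ) : ℝ := 1 / ((n.factorial : ℝ) * Real.Gamma (v + n + 1))

/-- The entire function `φ_v(z) = ∑ zⁿ / (n! Γ(v+n+1))`. -/
noncomputable def besselPhi (v z : ℝ) : ℝ := ∑' n : ℕ, besselCoeff v n * z ^ n

/-- The order `v` is not an integer. -/
def NonIntegral (v : ℝ) : Prop := ∀ n : ℤ, v ≠ n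

theorem NonIntegral.add_int {v : ℝ} (hv : NonIntegral v) (m : ℤ) : NonIntegral (v + m) :=
  fun n h => hv (n - m) (by push_cast; linarith)

theorem NonIntegral.add_one {v : ℝ} (hv : NonIntegral v) : NonIntegral (v + 1) := by
  simpa using hv.add_int 1

theorem NonIntegral.neg {v : ℝ} (hv : NonIntegral v) : NonIntegral (-v) :=
  fun n h => hv (-n) (by push_cast; linarith)

theorem NonIntegral.sin_ne_zero {v : ℝ} (hv : NonIntegral v) : Real.sin (v * Real.pi) ≠ 0 := by
  intro h
  obtain ⟨n, hn⟩ := Real.sin_eq_zero_iff.1 h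
  exact hv n (mul_right_cancel₀ Real.pi_ne_zero hn).symm

theorem nonIntegral_of_mem_Ioo {v : ℝ} (h0 : 0 < v) (h1 : v < 1) : NonIntegral v := by
  rintro n rfl
  norm_cast at h0 h1
  omega

theorem NonIntegral.Gamma_ne_zero {v : ℝ} (hv : NonIntegral v) (n : ℕ) :
    Real.Gamma (v + n + 1) ≠ 0 :=
  Real.Gamma_ne_zero fun m h => hv (-m - n - 1) (by push_cast; linarith)

theorem besselCoeff_ne_zero {v : ℝ} (hv : NonIntegral v) (n : ℕ) : besselCoeff v n ≠ 0 :=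
  one_div_ne_zero (mul_ne_zero (by positivity) (hv.Gamma_ne_zero n))

theorem succ_mul_besselCoeff (v : ℝ) (n : ℕ) :
    ((n : ℝ) + 1) * besselCoeff v (n + 1) = besselCoeff (v + 1) n := by
  unfold besselCoeff
  have e : v + ((n + 1 : ℕ) : ℝ) + 1 = v + 1 + n + 1 := by push_cast; ring
  rw [e, Nat.factorial_succ]
  push_cast
  -- At a pole both sides are `0`, by the convention for division by zero.
  by_cases h : Real.Gamma (v + 1 + n + 1) = 0
  · simp [h]
  · field_simp

theorem besselCoeff_eq_mul {v : ℝ} (hv : NonIntegral v) (n : ℕ) :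
    besselCoeff v n = (v + n + 1) * besselCoeff (v + 1) n := by
  unfold besselCoeff
  have h1 : v + n + 1 ≠ 0 := fun h => hv (-n - 1) (by push_cast; linarith)
  have h2 := hv.Gamma_ne_zero n
  have e : v + 1 + (n : ℝ) + 1 = (v + n + 1) + 1 := by ring
  rw [e, Real.Gamma_add_one h1]
  field_simp

theorem summable_besselCoeff {v : ℝ} (hv : NonIntegral v) (z : ℝ) :
    Summable fun n => |besselCoeff v n * z ^ n| := by
  rcases eq_or_ne z 0 with rfl | hz
  · refine summable_of_ne_finset_zero (s := {0}) fun n hn => ?_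
    simp only [Finset.mem_singleton] at hn
    simp [hn]
  refine summable_of_ratio_test_tendsto_lt_one zero_lt_one
    (.of_forall fun n => abs_ne_zero.2 (mul_ne_zero (besselCoeff_ne_zero hv n) (pow_ne_zero n hz))) ?_
  have e : ∀ n : ℕ, ‖|besselCoeff v (n + 1) * z ^ (n + 1)|‖ / ‖|besselCoeff v n * z ^ n|‖ =
      |z / ((n + 1) * (v + n + 1))| := fun n => by
    rw [Real.norm_eq_abs, Real.norm_eq_abs, abs_abs, abs_abs, ← abs_div]
    have h1 : v + n + 1 ≠ 0 := fun h => hv (-n - 1) (by push_cast; linarith)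
    have h2 := besselCoeff_ne_zero hv.add_one n
    rw [besselCoeff_eq_mul hv n, ← succ_mul_besselCoeff] at *
    have h3 : besselCoeff v (n + 1) ≠ 0 := right_ne_zero_of_mul h2
    congr 1
    rw [pow_succ]
    field_simp
  simp only [e]
  have h1 : Tendsto (fun n : ℕ => ((n : ℝ) + 1) * (v + n + 1)) atTop atTop :=
    (tendsto_natCast_atTop_atTop.atTop_add tendsto_const_nhds).atTop_mul_atTop₀
      (((tendsto_const_nhds (x := v)).add_atTop tendsto_natCast_atTop_atTop).atTop_add
        tendsto_const_nhds)
  simpa using (h1.const_div_atTop z).abs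

theorem hasDerivAt_besselPhi {v : ℝ} (hv : NonIntegral v) (z : ℝ) :
    HasDerivAt (besselPhi v) (besselPhi (v + 1) z) z := by
  set R := |z| + 1
  have hR : 0 < R := by positivity
  have e : ∀ (n : ℕ) (y : ℝ), besselCoeff v (n + 1) * (((n + 1 : ℕ) : ℝ) * y ^ (n + 1 - 1)) =
      besselCoeff (v + 1) n * y ^ n := fun n y => by
    rw [← succ_mul_besselCoeff]
    push_cast
    ring
  have hu : Summable fun n : ℕ => |besselCoeff v n * (n * R ^ (n - 1))| := by
    rw [← summable_nat_add_iff 1]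
    simp only [e]
    exact summable_besselCoeff hv.add_one R
  have hb : ∀ (n : ℕ), ∀ y ∈ Metric.ball (0 : ℝ) R,
      ‖besselCoeff v n * (n * y ^ (n - 1))‖ ≤ |besselCoeff v n * (n * R ^ (n - 1))| := by
    intro n y hy
    rw [mem_ball_zero_iff, Real.norm_eq_abs] at hy
    rw [Real.norm_eq_abs, abs_mul, abs_mul, abs_mul, abs_mul, abs_pow, abs_pow, abs_of_pos hR]
    gcongr
  have hz : z ∈ Metric.ball (0 : ℝ) R := by
    rw [mem_ball_zero_iff, Real.norm_eq_abs]
    exact lt_add_one _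
  have h := hasDerivAt_tsum_of_isPreconnected hu Metric.isOpen_ball
    (convex_ball (0 : ℝ) R).isPreconnected
    (fun n y _ => (hasDerivAt_pow n y).const_mul (besselCoeff v n)) hb hz
    (summable_besselCoeff hv z).of_abs hz
  refine h.congr_deriv ?_
  rw [(Summable.of_norm_bounded hu fun n => hb n z hz).tsum_eq_zero_add]
  simp only [e]
  simp [besselPhi]

theorem continuous_besselPhi {v : ℝ} (hv : NonIntegral v) : Continuous (besselPhi v) :=
  continuous_iff_continuousAt.2 fun z => (hasDerivAt_besselPhi hv z).continuousAt

theorem besselPhi_eq_add {v : ℝ} (hv : NonIntegral v) (z : ℝ) :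
    besselPhi v z = (v + 1) * besselPhi (v + 1) z + z * besselPhi (v + 2) z := by
  have s0 := (summable_besselCoeff hv z).of_abs
  have s1 := (summable_besselCoeff hv.add_one z).of_abs
  have s2 := (summable_besselCoeff hv.add_one.add_one z).of_abs
  have e2 : v + 2 = v + 1 + 1 := by ring
  have e : ∀ n, besselCoeff v (n + 1) * z ^ (n + 1) = (v + 1) * (besselCoeff (v + 1) (n + 1) *
      z ^ (n + 1)) + z * (besselCoeff (v + 1 + 1) n * z ^ n) := fun n => by
    rw [besselCoeff_eq_mul hv, ← succ_mul_besselCoeff (v + 1)]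
    push_cast
    ring
  unfold besselPhi
  rw [e2, s0.tsum_eq_zero_add, s1.tsum_eq_zero_add]
  simp only [e]
  rw [Summable.tsum_add (((summable_nat_add_iff 1).2 s1).mul_left _) (s2.mul_left _), tsum_mul_left,
    tsum_mul_left, besselCoeff_eq_mul hv]
  push_cast
  ring

theorem besselI_eq {x : ℝ} (hx : 0 < x) (v : ℝ) :
    besselI v x = (x / 2) ^ v * besselPhi v ((x / 2) ^ 2) := by
  unfold besselI besselPhi
  rw [← tsum_mul_left]
  refine tsum_congr fun n => ?_
  have h2 : 0 < x / 2 := half_pos hx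
  rw [Real.rpow_add h2, Real.rpow_mul h2.le, Real.rpow_natCast, Real.rpow_two, besselCoeff]
  ring

theorem hasDerivAt_besselI {v : ℝ} (hv : NonIntegral v) {x : ℝ} (hx : 0 < x) :
    HasDerivAt (besselI v) (besselI (v + 1) x + v / x * besselI v x) x := by
  have h2 : 0 < x / 2 := half_pos hx
  have hd : HasDerivAt (fun y : ℝ => y / 2) (1 / 2) x := (hasDerivAt_id x).div_const 2
  have h := (hd.rpow_const (p := v) (Or.inl h2.ne')).mul
    ((hasDerivAt_besselPhi hv ((x / 2) ^ 2)).comp x (hd.pow 2))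
  refine (h.congr_of_eventuallyEq ?_).congr_deriv ?_
  · filter_upwards [Ioi_mem_nhds hx] with y hy
    exact besselI_eq hy v
  · rw [besselI_eq hx, besselI_eq hx, Real.rpow_sub_one h2.ne', Real.rpow_add_one h2.ne']
    simp only [Function.comp, Pi.pow_apply]
    field_simp
    ring

theorem besselI_sub_one {v : ℝ} (hv : NonIntegral v) {x : ℝ} (hx : 0 < x) :
    besselI (v - 1) x = besselI (v + 1) x + 2 * v / x * besselI v x := by
  have h2 : 0 < x / 2 := half_pos hx
  have hv1 : NonIntegral (v - 1) := by simpa [sub_eq_add_neg] using hv.add_int (-1)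
  have h := besselPhi_eq_add hv1 ((x / 2) ^ 2)
  rw [sub_add_cancel, show v - 1 + 2 = v + 1 by ring] at h
  rw [besselI_eq hx, besselI_eq hx, besselI_eq hx, Real.rpow_sub_one h2.ne',
    Real.rpow_add_one h2.ne', h]
  field_simp
  ring

/-! ### The quotient and its identification with the integral -/

theorem besselKQuot_neg (v x : ℝ) : besselKQuot (-v) x = besselKQuot v x := by
  unfold besselKQuot
  rw [neg_neg, neg_mul, Real.sin_neg, div_neg, ← neg_div, neg_sub]

/-- The sign change of `sin(vπ)` under `v ↦ v + 1` turns the relations for `I` into the same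
derivative formula as in `hasDerivAt_besselKInt`. -/
theorem hasDerivAt_besselKQuot {v : ℝ} (hv : NonIntegral v) {x : ℝ} (hx : 0 < x) :
    HasDerivAt (besselKQuot v) (-besselKQuot (v + 1) x + v / x * besselKQuot v x) x := by
  have h := (((hasDerivAt_besselI hv.neg hx).sub (hasDerivAt_besselI hv hx)).div_const
    (Real.sin (v * Real.pi))).const_mul (Real.pi / 2)
  refine h.congr_deriv ?_
  have r := besselI_sub_one hv.neg hx
  have hs := hv.sin_ne_zero
  have e : Real.sin ((v + 1) * Real.pi) = -Real.sin (v * Real.pi) := by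
    rw [add_mul, one_mul, Real.sin_add_pi]
  unfold besselKQuot
  rw [e, neg_add, ← sub_eq_add_neg, r]
  field_simp
  ring

/-- Only `I_(-v)` contributes, through `1/Γ(1 - v)`; the reflection formula converts this to the
constant found for the integral. -/
theorem tendsto_rpow_mul_besselKQuot {v : ℝ} (h0 : 0 < v) (h1 : v < 1) :
    Tendsto (fun x => x ^ v * besselKQuot v x) (𝓝[>] 0) (𝓝 (2 ^ (v - 1) * Real.Gamma v)) := by
  have hv := nonIntegral_of_mem_Ioo h0 h1
  have hs := hv.sin_ne_zero
  have c1 := continuous_besselPhi hv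
  have c2 := continuous_besselPhi hv.neg
  have c3 : Continuous fun x : ℝ => x ^ v := Real.continuous_rpow_const h0.le
  have hc : Continuous fun x : ℝ => Real.pi / 2 / Real.sin (v * Real.pi) *
      (2 ^ v * besselPhi (-v) ((x / 2) ^ 2) - x ^ v * ((x / 2) ^ v * besselPhi v ((x / 2) ^ 2))) := by
    have := c3.comp (continuous_id.div_const 2)
    simp only [Function.comp_def, id] at this
    fun_prop
  have hl := (hc.tendsto 0).mono_left (nhdsWithin_le_nhds (s := Ioi 0))
  have e0 : Real.pi / 2 / Real.sin (v * Real.pi) *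
      (2 ^ v * besselPhi (-v) ((0 / 2) ^ 2) - 0 ^ v * ((0 / 2) ^ v * besselPhi v ((0 / 2) ^ 2))) =
      2 ^ (v - 1) * Real.Gamma v := by
    have hp : besselPhi (-v) 0 = 1 / Real.Gamma (1 - v) := by
      unfold besselPhi
      rw [tsum_eq_single 0 fun n hn => by simp [hn]]
      simp [besselCoeff, add_comm, sub_eq_add_neg]
    have hr := Real.Gamma_mul_Gamma_one_sub v
    have hg : Real.Gamma (1 - v) ≠ 0 := (Real.Gamma_pos_of_pos (by linarith)).ne'
    rw [mul_comm Real.pi v, eq_div_iff hs] at hr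
    rw [zero_div, zero_pow two_ne_zero, hp, Real.zero_rpow h0.ne', Real.rpow_sub_one two_ne_zero]
    generalize Real.sin (v * Real.pi) = s at hs hr
    field_simp
    linear_combination -(2 ^ v) * hr
  rw [e0] at hl
  refine hl.congr' (eventually_nhdsWithin_of_forall fun x (hx : 0 < x) => ?_)
  have hx2 : 0 < x / 2 := half_pos hx
  have e1 : x ^ v = (x / 2) ^ v * 2 ^ v := by
    rw [← Real.mul_rpow hx2.le two_pos.le, div_mul_cancel₀ x two_ne_zero]
  have e2 : (x / 2) ^ v * (x / 2) ^ (-v) = 1 := by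
    rw [← Real.rpow_add hx2, add_neg_cancel, Real.rpow_zero]
  beta_reduce
  unfold besselKQuot
  rw [besselI_eq hx, besselI_eq hx, e1]
  linear_combination -(Real.pi / 2 / Real.sin (v * Real.pi) * 2 ^ v *
    besselPhi (-v) ((x / 2) ^ 2)) * e2

/-- With `a = x^v f` and `b = x^(1-v) g` the system becomes `a' = -x^(2v-1) b`, `b' = -x^(1-2v) a`.
Since `W' = x^(2v-1) + x^(1-2v)`, the weighted energy `H = (a² + b²) e^(-W)` has derivative `-W' (a
+ b)² e^(-W) ≤ 0`. It is nonnegative and tends to `0` at `0`, so it vanishes. -/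
theorem eq_zero_of_hasDerivAt_of_tendsto_zero {f g : ℝ → ℝ} {v : ℝ} (h0 : 0 < v) (h1 : v < 1)
    (hf : ∀ x, 0 < x → HasDerivAt f (-g x - v / x * f x) x)
    (hg : ∀ x, 0 < x → HasDerivAt g (-f x - (1 - v) / x * g x) x)
    (lf : Tendsto (fun x => x ^ v * f x) (𝓝[>] 0) (𝓝 0))
    (lg : Tendsto (fun x => x ^ (1 - v) * g x) (𝓝[>] 0) (𝓝 0)) {x : ℝ} (hx : 0 < x) :
    f x = 0 := by
  set W : ℝ → ℝ := fun x => x ^ (2 * v) / (2 * v) + x ^ (2 - 2 * v) / (2 - 2 * v) with hW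
  set H : ℝ → ℝ := fun x => ((x ^ v * f x) ^ 2 + (x ^ (1 - v) * g x) ^ 2) * Real.exp (-W x) with hH
  have hWc : Continuous W :=
    ((Real.continuous_rpow_const (by linarith)).div_const _).add
      ((Real.continuous_rpow_const (by linarith)).div_const _)
  have hHd : ∀ y, 0 < y → ∃ d ≤ 0, HasDerivAt H d y := fun y hy => by
    have dW : HasDerivAt W (y ^ (2 * v - 1) + y ^ (1 - 2 * v)) y := by
      have := ((Real.hasDerivAt_rpow_const (p := 2 * v) (Or.inl hy.ne')).div_const (2 * v)).add
        ((Real.hasDerivAt_rpow_const (p := 2 - 2 * v) (Or.inl hy.ne')).div_const (2 - 2 * v))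
      refine this.congr_deriv ?_
      have e1 : 2 * v ≠ 0 := by positivity
      have e2 : 2 - 2 * v ≠ 0 := by linarith
      rw [mul_div_cancel_left₀ _ e1, mul_div_cancel_left₀ _ e2]
      ring_nf
    have dp := (Real.hasDerivAt_rpow_const (p := v) (Or.inl hy.ne')).mul (hf y hy)
    have dq := (Real.hasDerivAt_rpow_const (p := 1 - v) (Or.inl hy.ne')).mul (hg y hy)
    refine ⟨_, ?_, ((dp.pow 2).add (dq.pow 2)).mul dW.neg.exp⟩
    have e1 : y ^ v = y ^ (2 * v - 1) * y ^ (1 - v) := by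
      rw [← Real.rpow_add hy]; ring_nf
    have e2 : y ^ (1 - v) = y ^ (1 - 2 * v) * y ^ v := by
      rw [← Real.rpow_add hy]; ring_nf
    have e3 : v * y ^ (v - 1) * f y + y ^ v * (-g y - v / y * f y) =
        -(y ^ (2 * v - 1) * (y ^ (1 - v) * g y)) := by
      rw [← mul_assoc (y ^ (2 * v - 1)), ← e1, Real.rpow_sub_one hy.ne']
      field_simp
      ring
    have e4 : (1 - v) * y ^ (1 - v - 1) * g y + y ^ (1 - v) * (-f y - (1 - v) / y * g y) =
        -(y ^ (1 - 2 * v) * (y ^ v * f y)) := by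
      rw [← mul_assoc (y ^ (1 - 2 * v)), ← e2, Real.rpow_sub_one hy.ne']
      field_simp
      ring
    simp only [Pi.add_apply, Pi.pow_apply, Pi.mul_apply, Pi.neg_apply]
    rw [e3, e4]
    have ha : 0 < y ^ (2 * v - 1) := Real.rpow_pos_of_pos hy _
    have hb : 0 < y ^ (1 - 2 * v) := Real.rpow_pos_of_pos hy _
    generalize y ^ (2 * v - 1) = α at *
    generalize y ^ (1 - 2 * v) = β at *
    generalize y ^ v * f y = a
    generalize y ^ (1 - v) * g y = b
    have h : 0 ≤ (α + β) * (a + b) ^ 2 * Real.exp (-W y) := by positivity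
    push_cast
    linear_combination h
  have hanti : AntitoneOn H (Ioi 0) := by
    refine antitoneOn_of_deriv_nonpos (convex_Ioi 0) (fun y hy => ?_) (fun y hy => ?_) fun y hy => ?_
    · obtain ⟨d, -, hd⟩ := hHd y hy
      exact hd.continuousAt.continuousWithinAt
    · obtain ⟨d, -, hd⟩ := hHd y (interior_subset hy)
      exact hd.differentiableAt.differentiableWithinAt
    · obtain ⟨d, hd0, hd⟩ := hHd y (interior_subset hy)
      rwa [hd.deriv]
  have hl : Tendsto H (𝓝[>] 0) (𝓝 0) := by
    have := ((lf.pow 2).add (lg.pow 2)).mul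
      ((hWc.neg.rexp.tendsto 0).mono_left (nhdsWithin_le_nhds (s := Ioi 0)))
    simpa using this
  have hle : H x ≤ 0 := ge_of_tendsto hl <| by
    filter_upwards [Ioo_mem_nhdsGT hx] with y hy
    exact hanti hy.1 hx hy.2.le
  have hE : (x ^ v * f x) ^ 2 + (x ^ (1 - v) * g x) ^ 2 ≤ 0 :=
    nonpos_of_mul_nonpos_left hle (Real.exp_pos _)
  have hz : x ^ v * f x = 0 := pow_eq_zero_iff two_ne_zero |>.1
    (le_antisymm (by linarith [sq_nonneg (x ^ (1 - v) * g x)]) (sq_nonneg _))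
  exact (mul_eq_zero.1 hz).resolve_left (Real.rpow_pos_of_pos hx v).ne'

theorem besselKInt_eq_besselKQuot_of_mem_Ioo {v : ℝ} (h0 : 0 < v) (h1 : v < 1) {x : ℝ}
    (hx : 0 < x) : besselKInt v x = besselKQuot v x := by
  have key : ∀ w : ℝ, 0 < w → w < 1 → ∀ y : ℝ, 0 < y →
      HasDerivAt (fun z => besselKInt w z - besselKQuot w z)
        (-(besselKInt (1 - w) y - besselKQuot (1 - w) y) -
          w / y * (besselKInt w y - besselKQuot w y)) y := by
    intro w hw0 hw1 y hy
    have hn := nonIntegral_of_mem_Ioo hw0 hw1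
    -- Raising the order from `-w` gives `1 - w`, so evenness closes the system on `w` and `1 - w`.
    have d1 := hasDerivAt_besselKInt hy (-w)
    have d2 := hasDerivAt_besselKQuot hn.neg hy
    have c1 : besselKInt (-w) = besselKInt w := funext fun z => besselKInt_neg w z
    have c2 : besselKQuot (-w) = besselKQuot w := funext fun z => besselKQuot_neg w z
    rw [c1, neg_add_eq_sub] at d1
    rw [c2, neg_add_eq_sub] at d2
    exact (d1.sub d2).congr_deriv (by ring_nf)
  have lim : ∀ w : ℝ, 0 < w → w < 1 →
      Tendsto (fun z => z ^ w * (besselKInt w z - besselKQuot w z)) (𝓝[>] 0) (𝓝 0) := by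
    intro w hw0 hw1
    simpa only [mul_sub, sub_self] using
      (tendsto_rpow_mul_besselKInt hw0).sub (tendsto_rpow_mul_besselKQuot hw0 hw1)
  refine sub_eq_zero.1 (eq_zero_of_hasDerivAt_of_tendsto_zero h0 h1 (key v h0 h1) ?_ (lim v h0 h1)
    (lim (1 - v) (by linarith) (by linarith)) hx)
  have := key (1 - v) (by linarith) (by linarith)
  rwa [sub_sub_cancel] at this

theorem besselKInt_eq_besselKQuot {v : ℝ} (hv : NonIntegral v) {x : ℝ} (hx : 0 < x) :
    besselKInt v x = besselKQuot v x := by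
  have nat : ∀ (n : ℕ) (w : ℝ), 0 < w → w < 1 → ∀ y, 0 < y →
      besselKInt (w + n) y = besselKQuot (w + n) y := by
    intro n w h0 h1
    induction n with
    | zero => simpa using fun y hy => besselKInt_eq_besselKQuot_of_mem_Ioo h0 h1 hy
    | succ n ih =>
      intro y hy
      have hn : NonIntegral (w + n) := (nonIntegral_of_mem_Ioo h0 h1).add_int n
      have d1 := hasDerivAt_besselKInt hy (w + n)
      have d2 := (hasDerivAt_besselKQuot hn hy).congr_of_eventuallyEq
        (by filter_upwards [Ioi_mem_nhds hy] with z hz using ih z hz)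
      -- Equal derivatives at order `w + n` force equality at order `w + n + 1`.
      have := d1.unique d2
      rw [ih y hy] at this
      push_cast
      rw [← add_assoc]
      linarith
  have pos : ∀ w, 0 ≤ w → NonIntegral w → besselKInt w x = besselKQuot w x := by
    intro w h0 hw
    have h := nat ⌊w⌋₊ (w - ⌊w⌋₊)
      (sub_pos.2 ((Nat.floor_le h0).lt_of_ne fun h => hw ⌊w⌋₊ (by simpa using h.symm)))
      (by linarith [Nat.lt_floor_add_one w]) x hx
    rwa [sub_add_cancel] at h
  rcases le_total 0 v with h | h
  · exact pos v h hv
  · rw [← besselKInt_neg, ← besselKQuot_neg]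
    exact pos (-v) (by linarith) hv.neg

/-- The integral representation of the modified Bessel function of the second kind. -/
theorem besselK_eq_besselKInt (v : ℝ) {x : ℝ} (hx : 0 < x) : besselK v x = besselKInt v x := by
  unfold besselK
  split_ifs with h
  · refine Tendsto.limUnder_eq ?_
    have hc := ((continuous_besselKInt_order hx).tendsto v).mono_left
      (nhdsWithin_le_nhds (s := {v}ᶜ))
    refine hc.congr' ?_
    obtain ⟨n, rfl⟩ := h
    filter_upwards [self_mem_nhdsWithin, mem_nhdsWithin_of_mem_nhds
      (Ioo_mem_nhds (sub_one_lt (n : ℝ)) (lt_add_one (n : ℝ)))] with w hw1 hw2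
    refine besselKInt_eq_besselKQuot (fun m hm => hw1 ?_) hx
    subst hm
    obtain ⟨h1, h2⟩ := hw2
    norm_cast at h1 h2
    have : m = n := by omega
    simp [this]
  · exact (besselKInt_eq_besselKQuot (fun n hn => h ⟨n, hn⟩) hx).symm

/-! ### Comparison arguments for differential inequalities -/

theorem le_of_hasDerivAt_div_add_le {g g' : ℝ → ℝ} {a b s t : ℝ} (hs : 0 < s) (hst : s ≤ t)
    (hg : ∀ x ∈ Icc s t, HasDerivAt g (g' x) x) (hb : ∀ x ∈ Icc s t, a / x + b ≤ g' x) :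
    a * (Real.log t - Real.log s) + b * (t - s) ≤ g t - g s := by
  have hd : ∀ x ∈ Icc s t, HasDerivAt (fun x => g x - (a * Real.log x + b * x))
      (g' x - (a * x⁻¹ + b * 1)) x := fun x hx =>
    (hg x hx).sub (((Real.hasDerivAt_log (hs.trans_le hx.1).ne').const_mul a).add
      ((hasDerivAt_id x).const_mul b))
  have hm : MonotoneOn (fun x => g x - (a * Real.log x + b * x)) (Icc s t) := by
    refine monotoneOn_of_deriv_nonneg (convex_Icc s t)
      (fun x hx => (hd x hx).continuousAt.continuousWithinAt)
      (fun x hx => (hd x (interior_subset hx)).differentiableAt.differentiableWithinAt)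
      fun x hx => ?_
    rw [(hd x (interior_subset hx)).deriv]
    have := hb x (interior_subset hx)
    rw [div_eq_mul_inv] at this
    linarith
  have := hm (left_mem_Icc.2 hst) (right_mem_Icc.2 hst) hst
  simp only at this
  linarith

theorem not_bddAbove_of_hasDerivAt_div_add_le {g g' : ℝ → ℝ} {a b s C : ℝ} (hs : 0 < s)
    (hab : 0 < b ∨ b = 0 ∧ 0 < a) (hg : ∀ x ∈ Ici s, HasDerivAt g (g' x) x)
    (hb : ∀ x ∈ Ici s, a / x + b ≤ g' x) (hC : ∀ x ∈ Ici s, g x ≤ C) : False := by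
  have ht : Tendsto (fun x => a * Real.log x + b * x) atTop atTop := by
    rcases hab with h | ⟨rfl, h⟩
    · have h1 : Tendsto (fun x => a * (Real.log x / x) + b) atTop (𝓝 (a * 0 + b)) := by
        have := Real.isLittleO_log_id_atTop.tendsto_div_nhds_zero
        exact (this.const_mul a).add_const b
      rw [mul_zero, zero_add] at h1
      refine (tendsto_id.atTop_mul_pos h h1).congr' ?_
      filter_upwards [eventually_gt_atTop 0] with x hx
      simp only [id]
      field_simp
    · simpa using Real.tendsto_log_atTop.const_mul_atTop h
  obtain ⟨x, hx1, hx2⟩ := ((ht.eventually_gt_atTop (C - g s + (a * Real.log s + b * s))).and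
    (eventually_ge_atTop s)).exists
  have h := le_of_hasDerivAt_div_add_le hs hx2 (fun y hy => hg y hy.1) (fun y hy => hb y hy.1)
  have := hC x hx2
  linarith

/-- A function strictly increasing through the level `c` at every contact cannot cross it downwards.
-/
theorem le_of_hasDerivAt_pos_of_eq {g g' : ℝ → ℝ} {c s : ℝ} (h0 : c ≤ g s)
    (hg : ∀ x ∈ Ici s, HasDerivAt g (g' x) x) (hpos : ∀ x ∈ Ici s, g x = c → 0 < g' x) :
    ∀ x ∈ Ici s, c ≤ g x := by
  intro t ht
  have := image_le_of_deriv_right_lt_deriv_boundary (f := fun x => -g x) (f' := fun x => -g' x)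
    (a := s) (b := t) (B := fun _ => -c) (B' := fun _ => 0)
    (fun x hx => (hg x hx.1).neg.continuousAt.continuousWithinAt)
    (fun x hx => (hg x hx.1).neg.hasDerivWithinAt) (neg_le_neg h0)
    (fun x => hasDerivAt_const x _)
    (fun x hx he => by
      have := hpos x hx.1 (neg_injective he)
      linarith) (right_mem_Icc.2 ht)
  exact neg_le_neg_iff.1 this

/-- A solution bounded above of a differential inequality which forces unbounded growth
above the level `c` stays below `c`. -/
theorem lt_of_bddAbove_of_hasDerivAt {g g' : ℝ → ℝ} {a b c C : ℝ} (ha : 0 ≤ a) (hb : 0 ≤ b)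
    (hab : 0 < a ∨ 0 < b) (hg : ∀ x, 0 < x → HasDerivAt g (g' x) x)
    (hd : ∀ x, 0 < x → c ≤ g x → a / x + b ≤ g' x) (hC : ∀ x, 0 < x → g x ≤ C) {x : ℝ}
    (hx : 0 < x) : g x < c := by
  by_contra! h
  have hpos : ∀ y ∈ Ici x, 0 < y := fun y hy => hx.trans_le hy
  have hge := le_of_hasDerivAt_pos_of_eq h (fun y hy => hg y (hpos y hy)) fun y hy he => by
    refine lt_of_lt_of_le ?_ (hd y (hpos y hy) he.ge)
    have := hpos y hy
    rcases hab with h | h <;> positivity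
  refine not_bddAbove_of_hasDerivAt_div_add_le hx ?_ (fun y hy => hg y (hpos y hy))
    (fun y hy => hd y (hpos y hy) (hge y hy)) fun y hy => hC y (hpos y hy)
  rcases hb.lt_or_eq with h | h
  · exact Or.inl h
  · exact Or.inr ⟨h.symm, hab.resolve_right (by simp [← h])⟩

/-- A solution on `(0, ∞)` of `u' = p(u)/x + q(u)` with values in an interval `(α, β)` on which
`p < 0 < q` decreases strictly from `β` to `α`. -/
theorem strictAntiOn_and_image_eq_of_hasDerivAt {u p q : ℝ → ℝ} {α β C : ℝ}
    (hu : ∀ x, 0 < x → HasDerivAt u (p (u x) / x + q (u x)) x)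
    (hmem : ∀ x, 0 < x → u x ∈ Ioo α β) (hp : ∀ s ∈ Ioo α β, p s < 0)
    (hq : ∀ s ∈ Ioo α β, 0 < q s) (hpc : Continuous p) (hqm : Monotone q)
    (hC : ∀ s ∈ Ioo α β, -C ≤ p s) :
    StrictAntiOn u (Ioi 0) ∧ u '' Ioi 0 = Ioo α β := by
  have hpC : ∀ x, 0 < x → -C / x ≤ p (u x) / x := fun x hx =>
    div_le_div_of_nonneg_right (hC _ (hmem x hx)) hx.le
  have hnonpos : ∀ x, 0 < x → p (u x) / x + q (u x) ≤ 0 := by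
    intro x hx
    by_contra! h
    have hpos : ∀ y ∈ Ici x, 0 < y := fun y hy => hx.trans_le hy
    -- As `p < 0`, the term `p(u x)/y` only improves as `y` grows: at the level `u x` the slope
    -- remains positive, so `u` stays above it and `q(u)` stays at least `q(u x) > 0`.
    have hge := le_of_hasDerivAt_pos_of_eq le_rfl (fun y hy => hu y (hpos y hy)) fun y hy he => by
      rw [he]
      have : p (u x) / x ≤ p (u x) / y := by
        rw [div_le_div_iff₀ hx (hpos y hy)]
        exact mul_le_mul_of_nonpos_left hy (hp _ (hmem x hx)).le
      linarith
    exact not_bddAbove_of_hasDerivAt_div_add_le (a := -C) (b := q (u x)) hx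
      (Or.inl (hq _ (hmem x hx))) (fun y hy => hu y (hpos y hy))
      (fun y hy => add_le_add (hpC y (hpos y hy)) (hqm (hge y hy)))
      fun y hy => (hmem y (hpos y hy)).2.le
  have hcont : ContinuousOn u (Ioi 0) := fun x hx => (hu x hx).continuousAt.continuousWithinAt
  have hanti : AntitoneOn u (Ioi 0) := by
    refine antitoneOn_of_deriv_nonpos (convex_Ioi 0) hcont
      (fun x hx => (hu x (interior_subset hx)).differentiableAt.differentiableWithinAt)
      fun x hx => ?_
    rw [(hu x (interior_subset hx)).deriv]
    exact hnonpos x (interior_subset hx)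
  refine ⟨?_, ?_⟩
  · intro s hs t ht hst
    refine (hanti hs ht hst.le).lt_of_ne fun heq => ?_
    -- On a plateau `p(u s)/x + q(u s)` would vanish for every `x`, impossible with `p(u s) ≠ 0`.
    have hconst : ∀ x ∈ Ioo s t, u x = u s := fun x hx =>
      le_antisymm (hanti hs (lt_trans hs hx.1) hx.1.le)
        (heq ▸ hanti (lt_trans hs hx.1) ht hx.2.le)
    have hz : ∀ x ∈ Ioo s t, p (u s) / x + q (u s) = 0 := fun x hx => by
      have h1 := hu x (lt_trans hs hx.1)
      have h2 : HasDerivAt u 0 x := (hasDerivAt_const x (u s)).congr_of_eventuallyEq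
        (by filter_upwards [Ioo_mem_nhds hx.1 hx.2] with y hy using hconst y hy)
      rw [← hconst x hx]
      exact h1.unique h2
    obtain ⟨y, hy1, hy2⟩ := exists_between hst
    obtain ⟨z, hz1, hz2⟩ := exists_between hy2
    have h1 := hz y ⟨hy1, hy2⟩
    have h2 := hz z ⟨hy1.trans hz1, hz2⟩
    have h3 : p (u s) / y = p (u s) / z := by linarith
    have hy0 : y ≠ 0 := (lt_trans hs hy1).ne'
    have hz0 : z ≠ 0 := (lt_trans (lt_trans hs hy1) hz1).ne'
    rw [div_eq_div_iff hy0 hz0] at h3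
    exact hz1.ne (mul_left_cancel₀ (hp _ (hmem s hs)).ne h3).symm
  · refine Subset.antisymm (image_subset_iff.2 fun x hx => hmem x hx) fun c hc => ?_
    obtain ⟨s, hs, hsc⟩ : ∃ s, 0 < s ∧ c ≤ u s := by
      by_contra! h
      have hle : ∀ x ∈ Ioc (0 : ℝ) 1, u 1 ≤ u x := fun x hx => hanti hx.1 (mem_Ioi.2 one_pos) hx.2
      -- If `u` stayed below `c`, then on `(0, 1]` its values would lie in the compact `[u 1, c]`,
      -- where `p ≤ p m < 0`; then `u` would blow up logarithmically at `0`.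
      obtain ⟨m, hm, hmax⟩ := (isCompact_Icc (a := u 1) (b := c)).exists_isMaxOn
        (nonempty_Icc.2 (h 1 one_pos).le) hpc.continuousOn
      have hmn : p m < 0 := hp m ⟨(hmem 1 one_pos).1.trans_le hm.1, hm.2.trans_lt hc.2⟩
      have hbd : ∀ x ∈ Ioc (0 : ℝ) 1, p m * Real.log x + q c * (x - 1) ≤ c - u 1 + q c := by
        intro x hx
        have h1 := le_of_hasDerivAt_div_add_le (g := fun x => -u x) (a := -p m) (b := -q c)
          hx.1 hx.2 (fun y hy => (hu y (hx.1.trans_le hy.1)).neg) fun y hy => by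
            have hy0 := hx.1.trans_le hy.1
            have h1 : p (u y) / y ≤ p m / y := div_le_div_of_nonneg_right
              (hmax ⟨hle y ⟨hy0, hy.2⟩, (h y hy0).le⟩) hy0.le
            have h2 := hqm (h y hy0).le
            rw [neg_div]
            linarith
        have h2 := h x hx.1
        have h3 := hq c hc
        rw [Real.log_one] at h1
        nlinarith
      have ht : Tendsto (fun x => p m * Real.log x) (𝓝[>] 0) atTop :=
        Real.tendsto_log_nhdsGT_zero.const_mul_atBot_of_neg hmn
      obtain ⟨x, hx1, hx2⟩ := ((ht.eventually_gt_atTop (c - u 1 + q c + q c)).and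
        (Ioc_mem_nhdsGT one_pos)).exists
      have h1 := hbd x hx2
      have h2 := mul_nonneg (hq c hc).le hx2.1.le
      linarith
    obtain ⟨t, ht, htc⟩ : ∃ t, 0 < t ∧ u t ≤ c := by
      by_contra! h
      have hpos : ∀ y ∈ Ici (1 : ℝ), 0 < y := fun y hy => one_pos.trans_le hy
      exact not_bddAbove_of_hasDerivAt_div_add_le (a := -C) (b := q c) one_pos
        (Or.inl (hq c hc)) (fun y hy => hu y (hpos y hy))
        (fun y hy => add_le_add (hpC y (hpos y hy)) (hqm (h y (hpos y hy)).le))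
        fun y hy => (hmem y (hpos y hy)).2.le
    exact isPreconnected_Ioi.intermediate_value ht hs hcont ⟨htc, hsc⟩

/-! ### The Riccati equation, monotonicity and range of `Λ` -/

theorem deriv_besselK (v : ℝ) {x : ℝ} (hx : 0 < x) :
    deriv (besselK v) x = deriv (besselKInt v) x :=
  EventuallyEq.deriv_eq <| by
    filter_upwards [Ioi_mem_nhds hx] with y hy using besselK_eq_besselKInt v hy

theorem besselLambda_eq (v : ℝ) {x : ℝ} (hx : 0 < x) :
    besselLambda v x = x + v - x * besselKInt (v + 1) x / besselKInt v x := by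
  have := (besselKInt_pos hx v).ne'
  unfold besselLambda
  rw [deriv_besselK v hx, besselK_eq_besselKInt v hx, (hasDerivAt_besselKInt hx v).deriv]
  field_simp
  ring

/-- The Riccati equation for `Λ`. -/
theorem hasDerivAt_besselLambda (v : ℝ) {x : ℝ} (hx : 0 < x) :
    HasDerivAt (besselLambda v)
      ((v ^ 2 - besselLambda v x ^ 2) / x + (2 * besselLambda v x + 1)) x := by
  have hJ := (besselKInt_pos hx v).ne'
  -- Using order `-(v + 1)` and evenness expresses the derivative of `K_(v+1)` through `K_v` and
  -- itself, without `K_(v+2)`.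
  have d2 := hasDerivAt_besselKInt hx (-(v + 1))
  have c : besselKInt (-(v + 1)) = besselKInt (v + 1) := funext fun z => besselKInt_neg (v + 1) z
  rw [c, show -(v + 1) + 1 = -v by ring, besselKInt_neg] at d2
  have d := ((hasDerivAt_id x).add_const v).sub
    (((hasDerivAt_id x).mul d2).div (hasDerivAt_besselKInt hx v) hJ)
  refine (d.congr_of_eventuallyEq ?_).congr_deriv ?_
  · filter_upwards [Ioi_mem_nhds hx] with y hy
    exact besselLambda_eq v hy
  · rw [besselLambda_eq v hx]
    simp only [Pi.mul_apply, id]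
    field_simp
    ring

theorem besselLambda_mem_Ico {v : ℝ} (hv : 0 ≤ v) {x : ℝ} (hx : 0 < x) :
    besselLambda v x ∈ Ico (-(v + 1 / 2)) 0 := by
  have := add_mul_logDeriv_besselKInt_mem hx hv
  rwa [← deriv_besselK v hx, ← besselK_eq_besselKInt v hx] at this

theorem besselLambda_mem_Ioo {v : ℝ} (hv : 0 ≤ v) (hne : v ≠ 1 / 2) {x : ℝ} (hx : 0 < x) :
    besselLambda v x ∈ Ioo (-max v (1 / 2)) (-min v (1 / 2)) := by
  have hm0 : 0 ≤ min v (1 / 2) := le_min hv (by norm_num)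
  have hmv := min_le_left v (1 / 2)
  have hm2 := min_le_right v (1 / 2)
  have hMv := le_max_left v (1 / 2)
  have hM2 := le_max_right v (1 / 2)
  constructor
  · rw [neg_lt]
    -- The rates `a` and `b` are the two Riccati terms evaluated at the endpoint; one vanishes there
    -- and the other is positive because `v ≠ 1/2`. The bound `C` is the crude one.
    refine lt_of_bddAbove_of_hasDerivAt (g := fun x => -besselLambda v x)
      (a := max v (1 / 2) ^ 2 - v ^ 2)
      (b := 2 * max v (1 / 2) - 1) (C := v + 1 / 2) (by nlinarith) (by linarith) ?_
      (fun y hy => (hasDerivAt_besselLambda v hy).neg) ?_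
      (fun y hy => by linarith [(besselLambda_mem_Ico hv hy).1]) hx
    · rcases hne.lt_or_gt with h | h
      · rw [max_eq_right h.le]
        left
        nlinarith
      · rw [max_eq_left h.le]
        right
        linarith
    · intro y hy hc
      rw [neg_add, ← neg_div, neg_sub]
      have : max v (1 / 2) ^ 2 ≤ besselLambda v y ^ 2 := by nlinarith
      gcongr
      linarith
  · refine lt_of_bddAbove_of_hasDerivAt (a := v ^ 2 - min v (1 / 2) ^ 2)
      (b := 1 - 2 * min v (1 / 2)) (C := 0) (by nlinarith) (by linarith) ?_
      (fun y hy => hasDerivAt_besselLambda v hy) ?_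
      (fun y hy => (besselLambda_mem_Ico hv hy).2.le) hx
    · rcases hne.lt_or_gt with h | h
      · rw [min_eq_left h.le]
        right
        linarith
      · rw [min_eq_right h.le]
        left
        nlinarith
    · intro y hy hc
      have : besselLambda v y ^ 2 ≤ min v (1 / 2) ^ 2 := by
        nlinarith [(besselLambda_mem_Ico hv hy).2]
      gcongr
      linarith

theorem strictMonoOn_and_image_besselLambda {v : ℝ} (hv : 1 / 2 < v) :
    StrictMonoOn (besselLambda v) (Ioi 0) ∧
      besselLambda v '' Ioi 0 = Ioo (-v) (-(1 / 2)) := by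
  obtain ⟨h1, h2⟩ := strictAntiOn_and_image_eq_of_hasDerivAt (u := fun x => -besselLambda v x)
    (p := fun s => s ^ 2 - v ^ 2) (q := fun s => 2 * s - 1) (α := 1 / 2) (β := v) (C := v ^ 2)
    (fun x hx => (hasDerivAt_besselLambda v hx).neg.congr_deriv (by ring))
    (fun x hx => by
      have := besselLambda_mem_Ioo (by linarith) hv.ne' hx
      rw [max_eq_left hv.le, min_eq_right hv.le] at this
      exact ⟨by linarith [this.2], by linarith [this.1]⟩)
    (fun s hs => by nlinarith [hs.1, hs.2]) (fun s hs => by linarith [hs.1]) (by fun_prop)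
    (fun s t h => by linarith) (fun s _ => by nlinarith)
  refine ⟨fun x hx y hy hxy => neg_lt_neg_iff.1 (h1 hx hy hxy), ?_⟩
  rw [← image_neg_Ioo, ← h2, image_image]
  simp

theorem strictAntiOn_and_image_besselLambda {v : ℝ} (hv : 0 ≤ v) (hv2 : v < 1 / 2) :
    StrictAntiOn (besselLambda v) (Ioi 0) ∧
      besselLambda v '' Ioi 0 = Ioo (-(1 / 2)) (-v) := by
  refine strictAntiOn_and_image_eq_of_hasDerivAt (p := fun s => v ^ 2 - s ^ 2)
    (q := fun s => 2 * s + 1) (C := 1 / 4) (fun x hx => hasDerivAt_besselLambda v hx)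
    (fun x hx => by
      have := besselLambda_mem_Ioo hv hv2.ne hx
      rwa [max_eq_right hv2.le, min_eq_left hv2.le] at this)
    (fun s hs => by nlinarith [hs.1, hs.2]) (fun s hs => by linarith [hs.1]) (by fun_prop)
    (fun s t h => by linarith) (fun s hs => by nlinarith [hs.1, hs.2])

theorem image_besselLambda {v : ℝ} (hv : 0 ≤ v) (hne : v ≠ 1 / 2) :
    besselLambda v '' Ioi 0 = Ioo (-max v (1 / 2)) (-min v (1 / 2)) := by
  rcases hne.lt_or_gt with h | h
  · rw [max_eq_right h.le, min_eq_left h.le]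
    exact (strictAntiOn_and_image_besselLambda hv h).2
  · rw [max_eq_left h.le, min_eq_right h.le]
    exact (strictMonoOn_and_image_besselLambda h).2

theorem mainTheorem4 (v : ℝ) (hv : 0 ≤ v) :
    -- well-definedness of `Λ` on `(0, ∞)`
    (∀ x : ℝ, 0 < x → 0 < besselK v x ∧ DifferentiableAt ℝ (besselK v) x) ∧
    -- (i)
    (1 / 2 < v →
      StrictMonoOn (besselLambda v) (Ioi 0) ∧
      besselLambda v '' Ioi 0 = Ioo (-v) (-(1 / 2))) ∧
    -- (ii)
    (v < 1 / 2 →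
      StrictAntiOn (besselLambda v) (Ioi 0) ∧
      besselLambda v '' Ioi 0 = Ioo (-(1 / 2)) (-v)) ∧
    -- (iii) the double inequality, and optimality of both constants
    (v ≠ 1 / 2 →
      (∀ x : ℝ, 0 < x →
        -x - max v (1 / 2) < x * deriv (besselK v) x / besselK v x ∧
        x * deriv (besselK v) x / besselK v x < -x - min v (1 / 2)) ∧
      (∀ a : ℝ, (∀ x : ℝ, 0 < x → -x - a ≤ x * deriv (besselK v) x / besselK v x) →
        max v (1 / 2) ≤ a) ∧
      (∀ b : ℝ, (∀ x : ℝ, 0 < x → x * deriv (besselK v) x / besselK v x ≤ -x - b) →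
        b ≤ min v (1 / 2))) := by
  have hL : ∀ x, x * deriv (besselK v) x / besselK v x = besselLambda v x - x := fun x => by
    unfold besselLambda; ring
  refine ⟨fun x hx => ⟨?_, ?_⟩, strictMonoOn_and_image_besselLambda,
    strictAntiOn_and_image_besselLambda hv, fun hne => ?_⟩
  · rw [besselK_eq_besselKInt v hx]
    exact besselKInt_pos hx v
  · refine (hasDerivAt_besselKInt hx v).differentiableAt.congr_of_eventuallyEq ?_
    filter_upwards [Ioi_mem_nhds hx] with y hy using besselK_eq_besselKInt v hy
  simp only [hL]
  have him := image_besselLambda hv hne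
  have hlt : -max v (1 / 2) < -min v (1 / 2) := neg_lt_neg (min_lt_max.2 hne)
  refine ⟨fun x hx => ?_, fun a ha => ?_, fun b hb => ?_⟩
  · have := besselLambda_mem_Ioo hv hne hx
    exact ⟨by linarith [this.1], by linarith [this.2]⟩
  · refine neg_le_neg_iff.1 (le_of_forall_gt_imp_ge_of_dense fun s hs => ?_)
    -- The minimum keeps `t` inside the range of `Λ`, so `Λ` takes values arbitrarily close to its
    -- infimum.
    obtain ⟨t, ht1, ht2⟩ := exists_between (lt_min hs hlt)
    obtain ⟨x, hx, rfl⟩ := him.symm.subset ⟨ht1, ht2.trans_le (min_le_right _ _)⟩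
    linarith [ha x hx, min_le_left s (-min v (1 / 2))]
  · refine neg_le_neg_iff.1 (le_of_forall_lt_imp_le_of_dense fun s hs => ?_)
    obtain ⟨t, ht1, ht2⟩ := exists_between (max_lt hs hlt)
    obtain ⟨x, hx, rfl⟩ := him.symm.subset ⟨(le_max_right _ _).trans_lt ht1, ht2⟩
    linarith [hb x hx, le_max_left s (-max v (1 / 2))]
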